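/- **Conventions.** An *equivalence relation* on an object $A$ of a category is a jointly monic pair $p_1,p_2\colon R\rightrightarrows A$ that is reflexive, symmetric and transitive. A category is *regular* if it has finite limits, every kernel pair has a coequalizer, and regular epimorphisms are stable under pullback; it is *exact* (in the sense of Barr) if moreover every equivalence relation in it is the kernel pair of some morphism. A category $\mathcal X$ with finite limits has *stable coequalizers of equivalence relations* if every equivalence relation $R\rightrightarrows A$ in $\mathcal X$ has a coequalizer $q\colon A\to Q$ and, for every $f\colon Y\to Q$, the diagram $R\times_Q Y\rightrightarrows A\times_Q Y\to Y$ obtained by pulling back along $f$ is again a coequalizer. A category $\mathcal X$ is a *semi-localization* of a category $\mathcal C$ via $U\colon\mathcal X\to\mathcal C$ if $U$ is fully faithful and has a left adjoint $L$, with unit $\eta$, which is semi-left-exact: $L$ preserves every pullback of a morphism $Uf\colon UX\to ULQ$ (with $f\colon X\to LQ$ in $\mathcal X$) along $\eta_Q\colon Q\to ULQ$. It is a semi-localization of $\mathcal C$ if it is so via some $U$. For a regular category $\mathcal X$, the *exact completion* $\mathcal X_{\mathrm{ex/reg}}$ of $\mathcal X$ as a regular category is the full subcategory of the category of sheaves on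 $\mathcal X$ for the regular topology (whose covers are generated by single regular epimorphisms) consisting of the sheaves that are coequalizers, in sheaves, of $yR\rightrightarrows yA$ for an equivalence relation $R\rightrightarrows A$ in $\mathcal X$, where $y$ is the Yoneda embedding; $\mathcal X$ is embedded in it by $y$. (Sheaves take values in sets of a universe large enough for these coequalizers to exist.) **Theorem.** For a category $\mathcal X$, the following conditions are equivalent: (a) $\mathcal X$ has finite limits and stable coequalizers of equivalence relations; (b) $\mathcal X$ is a semi-localization of an exact category $\mathcal C$; (c) $\mathcal X$ is a semi-localization of an exact category $\mathcal C$, and the units of the reflection are regular epimorphisms; (d) $\mathcal X$ is regular, and is a semi-localization of its exact completion $\mathcal X_{\mathrm{ex/reg}}$ via the embedding $y\colon\mathcal X\to\mathcal X_{\mathrm{ex/reg}}$. In particular, a category satisfying (a) is regular. -/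

import Mathlib

open CategoryTheory Limits

universe u v u' v' w₁ w₂

namespace SemiLoc

/-- `X` has stable coequalizers of equivalence relations: every internal equivalence relation
`p₁, p₂ : R ⟶ A` has a coequalizer `q : A ⟶ Q`, and for every `f : Y ⟶ Q` the diagram
`S ⇉ A' ⟶ Y`, obtained from `R ⇉ A ⟶ Q` by pulling back along `f`, is again a coequalizer. -/
structure HasStableCoequalizersOfEquivalenceRelations
    (X : Type u) [Category.{v} X] : Prop where
  hasCoequalizer : ∀ {R A : X} (p₁ p₂ : R ⟶ A) [IsEquivalenceRelation p₁ p₂],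
    HasCoequalizer p₁ p₂
  stable : ∀ {R A Q : X} (p₁ p₂ : R ⟶ A) [IsEquivalenceRelation p₁ p₂]
    (q : A ⟶ Q) (w : p₁ ≫ q = p₂ ≫ q), Nonempty (IsColimit (Cofork.ofπ q w)) →
    ∀ {Y A' S : X} (f : Y ⟶ Q)
      (a : A' ⟶ A) (q' : A' ⟶ Y) (_ : IsPullback a q' q f)
      (r : S ⟶ R) (t : S ⟶ Y) (_ : IsPullback r t (p₁ ≫ q) f)
      (s₁ s₂ : S ⟶ A')
      (_ : s₁ ≫ a = r ≫ p₁) (h₁ : s₁ ≫ q' = t)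
      (_ : s₂ ≫ a = r ≫ p₂) (h₂ : s₂ ≫ q' = t),
      Nonempty (IsColimit (Cofork.ofπ q' (h₁.trans h₂.symm)))

/-- A (Barr-)exact category: a regular category in which every internal equivalence relation is
the kernel pair of some morphism. -/
class BarrExact (C : Type u) [Category.{v} C] : Prop extends Regular C where
  exists_isKernelPair : ∀ {R A : C} (p₁ p₂ : R ⟶ A) [IsEquivalenceRelation p₁ p₂],
    ∃ (B : C) (f : A ⟶ B), IsKernelPair f p₁ p₂

section Reflections

variable {X : Type u} [Category.{v} X] {C : Type u'} [Category.{v'} C]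

/-- The left adjoint `L` of an adjunction `L ⊣ U` with unit `η` is semi-left-exact: it preserves
every pullback
```
  P ----> U X
  |        |  U f
  v        v
  Q ----> U L Q
     η_Q
```
with `f : X ⟶ L Q`. -/
def SemiLeftExact {L : C ⥤ X} {U : X ⥤ C} (adj : L ⊣ U) : Prop :=
  ∀ ⦃Q P : C⦄ ⦃Y : X⦄ (f : Y ⟶ L.obj Q) (g : P ⟶ U.obj Y) (p : P ⟶ Q),
    IsPullback g p (U.map f) (adj.unit.app Q) →
    IsPullback (L.map g) (L.map p) (L.map (U.map f)) (L.map (adj.unit.app Q))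

/-- `U` exhibits `X` as a semi-localization of `C`: it is (the inclusion of) a full reflective
subcategory whose reflector is semi-left-exact. -/
def IsSemiLocalization (U : X ⥤ C) : Prop :=
  U.Full ∧ U.Faithful ∧ ∃ (L : C ⥤ X) (adj : L ⊣ U), SemiLeftExact adj

/-- `U` exhibits `X` as a semi-localization of `C`, and the units of the reflection are regular
epimorphisms. -/
def IsSemiLocalizationWithRegularEpiUnits (U : X ⥤ C) : Prop :=
  U.Full ∧ U.Faithful ∧ ∃ (L : C ⥤ X) (adj : L ⊣ U),
    SemiLeftExact adj ∧ ∀ Q : C, IsRegularEpi (adj.unit.app Q)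

end Reflections

section ExactCompletion

variable (X : Type u) [Category.{v} X] [Regular X]

/-- The category of sheaves on the regular category `X` for the regular topology, whose covers are
generated by single regular epimorphisms (in a category with pullbacks these are the same as
effective epimorphisms). The sheaves take values in a universe that is large enough for
quotients of representables by equivalence relations to exist, whatever the size of `X`. -/
abbrev RegSheaf : Type (max u v + 1) := Sheaf (regularTopology X) (Type (max v u))

/-- The embedding of `X` in its category of sheaves, sending an object to the sheaf that it
represents. -/
abbrev regYoneda : X ⥤ RegSheaf X := GrothendieckTopology.uliftYoneda.{u} (regularTopology X)

/-- The sheaves that are the quotient (in sheaves) of a representable sheaf `y A` by an equivalence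
relation `R ⇉ A` in `X`. -/
def isQuotient : ObjectProperty (RegSheaf X) := fun F =>
  ∃ (R A : X) (p₁ p₂ : R ⟶ A) (_ : IsEquivalenceRelation p₁ p₂)
    (q : (regYoneda X).obj A ⟶ F) (w : (regYoneda X).map p₁ ≫ q = (regYoneda X).map p₂ ≫ q),
    Nonempty (IsColimit (Cofork.ofπ q w))

/-- The exact completion (ex/reg completion) of the regular category `X`: the full subcategory of
the category of sheaves for the regular topology consisting of the quotients of representables by
equivalence relations in `X`. -/
abbrev ExReg : Type (max u v + 1) := (isQuotient X).FullSubcategory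

variable {X} in
theorem isQuotient_regYoneda (A : X) : isQuotient X ((regYoneda X).obj A) := by
  have hk : IsKernelPair (𝟙 A) (𝟙 A) (𝟙 A) := IsKernelPair.id_of_mono _
  refine ⟨A, A, 𝟙 A, 𝟙 A,
    (IsKernelPair.equivalenceRelation (𝟙 A) (𝟙 A) (𝟙 A) hk.isLimit hk).isEquivalenceRelation,
    𝟙 _, rfl, ⟨Cofork.IsColimit.mk _ (fun s => s.π) (fun s => ?_) (fun s m hm => ?_)⟩⟩
  · exact Category.id_comp _
  · exact (Category.id_comp m).symm.trans hm

/-- The inclusion `X ⥤ X_ex/reg` of a regular category in its exact completion. -/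
def toExReg : X ⥤ ExReg X := (isQuotient X).lift (regYoneda X) isQuotient_regYoneda

end ExactCompletion

end SemiLoc

/-! Stability of coequalizers in `X` and semi-left-exactness of the reflector are the same
condition, seen through an exact category `C` (`isIso_map_iff_isColimit`). Let `q : U A ⟶ Q` be a
regular epimorphism in `C` whose kernel pair is the image of `R ⇉ A`. The reflector turns it into
the coequalizer `A ⟶ L Q` of `R ⇉ A` in `X`. For `f : Y ⟶ L Q`, the pullback `P` of `U f` along the
unit is in the same way the quotient of `U A'` by `U S`, where `S ⇉ A'` is `R ⇉ A` pulled back along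
`f`. So `L P` is the coequalizer of `S ⇉ A'`, and `L P ⟶ Y` is invertible exactly when `S ⇉ A' ⟶ Y`
is a coequalizer.

If `C` is exact, every equivalence relation of `X` has such a quotient in `C`, which gives (a).
Conversely, (a) makes `X` regular, and every object of the exact completion is such a quotient.
Coequalizers in `X` then define the reflector, and its units are regular epimorphisms by right
cancellation.

It remains that the exact completion is exact. Sheaves form an exact category, and the quotients of
representables are closed in it under finite limits and under quotients by equivalence relations. -/

namespace SemiLoc

/-! ### Equivalence relations through generalized elements -/

section EquivalenceRelations

variable {C : Type u} [Category.{v} C] {D : Type u'} [Category.{v'} D]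

/-- The relation on generalized elements that is induced by a parallel pair. -/
def HomRel {R A : C} (p₁ p₂ : R ⟶ A) (T : C) (x y : T ⟶ A) : Prop :=
  ∃ r : T ⟶ R, r ≫ p₁ = x ∧ r ≫ p₂ = y

theorem equivalence_homRel {R A : C} (p₁ p₂ : R ⟶ A) [h : IsEquivalenceRelation p₁ p₂] (T : C) :
    Equivalence (HomRel p₁ p₂ T) := by
  obtain ⟨⟨e⟩⟩ := h
  refine ⟨fun x => ⟨x ≫ e.r, by simp, by simp⟩, ?_, ?_⟩
  · rintro _ _ ⟨r, rfl, rfl⟩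
    exact ⟨r ≫ e.s, by rw [Category.assoc, e.symmetry₁], by rw [Category.assoc, e.symmetry₂]⟩
  · rintro _ _ _ ⟨r, rfl, hr⟩ ⟨r', h', rfl⟩
    refine ⟨PullbackCone.IsLimit.lift e.isLimit r r' (hr.trans h'.symm) ≫ e.t, ?_, ?_⟩
    · rw [Category.assoc, e.transitivity₁, PullbackCone.IsLimit.lift_fst_assoc]
    · rw [Category.assoc, e.transitivity₂, PullbackCone.IsLimit.lift_snd_assoc]

theorem jointlyMono₂_of_isEquivalenceRelation {R A : C} (p₁ p₂ : R ⟶ A)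
    [h : IsEquivalenceRelation p₁ p₂] : JointlyMono₂ p₁ p₂ := by
  obtain ⟨⟨e⟩⟩ := h
  exact e.toJointlyMono₂

/-- By Yoneda, the structure maps come from generic elements: the identity of `A`, the identity of
`R`, and the universal composable pair. -/
theorem isEquivalenceRelation_of_homRel [HasPullbacks C] {R A : C} (p₁ p₂ : R ⟶ A)
    [hm : JointlyMono₂ p₁ p₂] (h : ∀ T : C, Equivalence (HomRel p₁ p₂ T)) :
    IsEquivalenceRelation p₁ p₂ := by
  obtain ⟨r, hr₁, hr₂⟩ := (h A).refl (𝟙 A)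
  obtain ⟨s, hs₁, hs₂⟩ := (h R).symm ⟨𝟙 R, Category.id_comp p₁, Category.id_comp p₂⟩
  obtain ⟨t, ht₁, ht₂⟩ := (h (pullback p₂ p₁)).trans
    ⟨pullback.fst p₂ p₁, rfl, rfl⟩ ⟨pullback.snd p₂ p₁, pullback.condition.symm, rfl⟩
  exact ⟨⟨{ hm with
    r := r, reflexivity₁ := hr₁, reflexivity₂ := hr₂, s := s, symmetry₁ := hs₁, symmetry₂ := hs₂
    c := _, isLimit := limit.isLimit _, t := t, transitivity₁ := ht₁, transitivity₂ := ht₂ }⟩⟩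

theorem isEquivalenceRelation_of_isKernelPair [HasPullbacks C] {R A B : C} {p₁ p₂ : R ⟶ A}
    {f : A ⟶ B} (h : IsKernelPair f p₁ p₂) : IsEquivalenceRelation p₁ p₂ :=
  (h.equivalenceRelation f p₁ p₂ (limit.isLimit _)).isEquivalenceRelation

theorem mono_prodLift [HasBinaryProducts C] {R A B : C} (p₁ : R ⟶ A) (p₂ : R ⟶ B)
    [h : JointlyMono₂ p₁ p₂] : Mono (prod.lift p₁ p₂) where
  right_cancellation f g w :=
    h.right_cancellation f g (by simpa only [Category.assoc, prod.lift_fst] using w =≫ prod.fst)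
      (by simpa only [Category.assoc, prod.lift_snd] using w =≫ prod.snd)

theorem jointlyMono₂_map [HasBinaryProducts C] [HasPullbacks C] (F : C ⥤ D)
    [PreservesFiniteLimits F] {R A B : C}
    (p₁ : R ⟶ A) (p₂ : R ⟶ B) [JointlyMono₂ p₁ p₂] : JointlyMono₂ (F.map p₁) (F.map p₂) where
  right_cancellation T f g w₁ w₂ := by
    have := mono_prodLift p₁ p₂
    rw [← cancel_mono (F.map (prod.lift p₁ p₂))]
    refine BinaryFan.IsLimit.hom_ext (mapIsLimitOfPreservesOfIsLimit F _ _ (prodIsProd A B)) ?_ ?_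
    · change (f ≫ _) ≫ F.map prod.fst = (g ≫ _) ≫ F.map prod.fst
      rwa [Category.assoc, Category.assoc, ← F.map_comp, prod.lift_fst]
    · change (f ≫ _) ≫ F.map prod.snd = (g ≫ _) ≫ F.map prod.snd
      rwa [Category.assoc, Category.assoc, ← F.map_comp, prod.lift_snd]

theorem isEquivalenceRelation_map [HasBinaryProducts C] [HasPullbacks C] (F : C ⥤ D)
    [PreservesFiniteLimits F] {R A : C} (p₁ p₂ : R ⟶ A) [h : IsEquivalenceRelation p₁ p₂] :
    IsEquivalenceRelation (F.map p₁) (F.map p₂) := by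
  have := jointlyMono₂_of_isEquivalenceRelation p₁ p₂
  have := jointlyMono₂_map F p₁ p₂
  obtain ⟨⟨e⟩⟩ := h
  exact ⟨⟨{ e.toReflexiveRelation.map F, e.toSymmetricRelation.map F,
    e.toTransitiveRelation.map F with }⟩⟩

/-- Testing on generalized elements means that `F` has to be full and faithful only; it need not
preserve the pullback on which transitivity is defined. -/
theorem isEquivalenceRelation_of_map [HasPullbacks C] (F : C ⥤ D) [F.Full] [F.Faithful] {R A : C}
    (p₁ p₂ : R ⟶ A) [IsEquivalenceRelation (F.map p₁) (F.map p₂)] :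
    IsEquivalenceRelation p₁ p₂ := by
  have hm := jointlyMono₂_of_isEquivalenceRelation (F.map p₁) (F.map p₂)
  have : JointlyMono₂ p₁ p₂ :=
    ⟨fun T f g w₁ w₂ => F.map_injective (hm.right_cancellation _ _
      (by simpa using congrArg F.map w₁) (by simpa using congrArg F.map w₂))⟩
  have key : ∀ (T : C) (x y : T ⟶ A),
      HomRel p₁ p₂ T x y ↔ HomRel (F.map p₁) (F.map p₂) (F.obj T) (F.map x) (F.map y) := by
    refine fun T x y => ⟨?_, ?_⟩
    · rintro ⟨r, rfl, rfl⟩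
      exact ⟨F.map r, by simp, by simp⟩
    · rintro ⟨r, h₁, h₂⟩
      obtain ⟨r, rfl⟩ := F.map_surjective r
      exact ⟨r, F.map_injective (by simpa using h₁), F.map_injective (by simpa using h₂)⟩
  refine isEquivalenceRelation_of_homRel p₁ p₂ fun T => ?_
  have e := equivalence_homRel (F.map p₁) (F.map p₂) (F.obj T)
  exact ⟨fun x => (key _ _ _).2 (e.refl _), fun h => (key _ _ _).2 (e.symm ((key _ _ _).1 h)),
    fun h h' => (key _ _ _).2 (e.trans ((key _ _ _).1 h) ((key _ _ _).1 h'))⟩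

end EquivalenceRelations

/-! ### Regular epimorphisms, images and kernel pairs -/

section RegularCategories

variable {C : Type u} [Category.{v} C]

theorem isRegularEpi_of_isPullback [Regular C] {A' A Y Q : C} {a : A' ⟶ A} {q' : A' ⟶ Y}
    {q : A ⟶ Q} {f : Y ⟶ Q} (h : IsPullback a q' q f) [IsRegularEpi q] : IsRegularEpi q' :=
  Regular.regularEpiIsStableUnderBaseChange.of_isPullback h ‹IsRegularEpi q›

theorem isRegularEpi_of_comp [Regular C] {A B D : C} (f : A ⟶ B) (g : B ⟶ D)
    [IsRegularEpi (f ≫ g)] : IsRegularEpi g :=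
  have := strongEpi_of_strongEpi f g
  inferInstance

theorem exists_regularEpi_mono_fac [Regular C] {A B : C} (f : A ⟶ B) :
    ∃ (I : C) (e : A ⟶ I) (m : I ⟶ B), IsRegularEpi e ∧ Mono m ∧ e ≫ m = f :=
  ⟨_, (Regular.strongEpiMonoFactorisation f).e, (Regular.strongEpiMonoFactorisation f).m,
    inferInstance, inferInstance, by simp⟩

/-- In an exact category every equivalence relation is the kernel pair of a regular
epimorphism. -/
theorem BarrExact.exists_isRegularEpi [BarrExact C] {R A : C} (p₁ p₂ : R ⟶ A)
    [IsEquivalenceRelation p₁ p₂] :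
    ∃ (Q : C) (q : A ⟶ Q), IsRegularEpi q ∧ IsKernelPair q p₁ p₂ := by
  obtain ⟨B, f, hf⟩ := BarrExact.exists_isKernelPair p₁ p₂
  obtain ⟨I, e, m, he, hm, rfl⟩ := exists_regularEpi_mono_fac f
  exact ⟨I, e, he, hf.cancel_right_of_mono⟩

/-- The kernel pair of a pullback of `q` is the pullback of the kernel pair of `q`. -/
theorem isKernelPair_of_isPullback {R A Q P A' S : C} {p₁ p₂ : R ⟶ A} {q : A ⟶ Q}
    (hq : IsKernelPair q p₁ p₂) {a : A' ⟶ A} {r : A' ⟶ P} {p : P ⟶ Q} (hr : IsPullback a r q p)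
    {ρ : S ⟶ R} {τ : S ⟶ P} (hρ : IsPullback ρ τ (p₁ ≫ q) p) {s₁ s₂ : S ⟶ A'}
    (h₁ : s₁ ≫ a = ρ ≫ p₁) (h₁' : s₁ ≫ r = τ) (h₂ : s₂ ≫ a = ρ ≫ p₂) (h₂' : s₂ ≫ r = τ) :
    IsKernelPair r s₁ s₂ := by
  subst h₁'
  have hs : IsPullback ρ s₁ p₁ a := IsPullback.of_bot hρ h₁.symm hr
  have hs' := hs.paste_horiz hq.flip
  rw [← h₂, hr.w] at hs'
  exact (IsPullback.of_right hs' h₂' hr).flip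

end RegularCategories

/-! ### Reflections of quotients, and the key equivalence -/

section Reflections

variable {X : Type u} [Category.{v} X] {C : Type u'} [Category.{v'} C]

theorem nonempty_isColimit_cofork_iff_isIso {R A Q Q' : X} {p₁ p₂ : R ⟶ A} {q : A ⟶ Q}
    {w : p₁ ≫ q = p₂ ≫ q} (hq : IsColimit (Cofork.ofπ q w)) {q' : A ⟶ Q'} (w' : p₁ ≫ q' = p₂ ≫ q')
    {φ : Q ⟶ Q'} (hφ : q ≫ φ = q') :
    Nonempty (IsColimit (Cofork.ofπ q' w')) ↔ IsIso φ := by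
  refine ⟨fun ⟨hq'⟩ => ?_, fun _ => ?_⟩
  · have : φ = (hq.coconePointUniqueUpToIso hq').hom := by
      refine Cofork.IsColimit.hom_ext hq (hφ.trans ?_)
      exact (hq.comp_coconePointUniqueUpToIso_hom hq' WalkingParallelPair.one).symm
    rw [this]
    infer_instance
  · exact ⟨hq.ofIsoColimit (Cofork.ext (asIso φ) hφ)⟩

variable {L : C ⥤ X} {U : X ⥤ C} (adj : L ⊣ U)

/-- A reflector takes the coequalizer in the ambient category of a pair in the subcategory to its
coequalizer in the subcategory. -/
theorem exists_isColimit_of_reflection [U.Full] [U.Faithful] {R A : X} {p₁ p₂ : R ⟶ A} {Q : C}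
    {q : U.obj A ⟶ Q} {w : U.map p₁ ≫ q = U.map p₂ ≫ q} (hq : IsColimit (Cofork.ofπ q w))
    {π : A ⟶ L.obj Q} (hπ : U.map π = q ≫ adj.unit.app Q) :
    ∃ w' : p₁ ≫ π = p₂ ≫ π, Nonempty (IsColimit (Cofork.ofπ π w')) := by
  refine ⟨U.map_injective (by simp [hπ, reassoc_of% w]), ⟨Cofork.IsColimit.ofExistsUnique
    fun s => ?_⟩⟩
  have ws : U.map p₁ ≫ U.map s.π = U.map p₂ ≫ U.map s.π := by
    simp only [← U.map_comp, s.condition]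
  obtain ⟨k, hk⟩ : ∃ k, q ≫ k = U.map s.π :=
    ⟨hq.desc (Cofork.ofπ (U.map s.π) ws), Cofork.IsColimit.π_desc hq⟩
  have huniv : ∀ d : L.obj Q ⟶ s.pt, π ≫ d = s.π ↔ adj.homEquiv _ _ d = k := by
    intro d
    rw [← U.map_injective.eq_iff, U.map_comp, hπ, ← hk, Category.assoc, adj.homEquiv_unit]
    exact ⟨fun h => Cofork.IsColimit.hom_ext hq h, fun h => by rw [h]⟩
  refine ⟨(adj.homEquiv _ _).symm k, (huniv _).2 (by simp), fun d hd => ?_⟩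
  rw [← (huniv d).1 hd, Equiv.symm_apply_apply]

variable {adj} in
/-- The pullback of `f : Y ⟶ L Q` along the unit at `Q` is preserved by the reflector if and only if
the coequalizer diagram that presents `L Q` is preserved by pulling back along `f`. -/
theorem isIso_map_iff_isColimit [Regular C] [U.Full] [U.Faithful] {R A : X} {p₁ p₂ : R ⟶ A} {Q : C}
    {q : U.obj A ⟶ Q} [IsRegularEpi q] (hq : IsKernelPair q (U.map p₁) (U.map p₂))
    {π : A ⟶ L.obj Q} (hπ : U.map π = q ≫ adj.unit.app Q)
    {Y A' S : X} {f : Y ⟶ L.obj Q} {a : A' ⟶ A} {q' : A' ⟶ Y} (ha : IsPullback a q' π f)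
    {r : S ⟶ R} {t : S ⟶ Y} (hr : IsPullback r t (p₁ ≫ π) f) {s₁ s₂ : S ⟶ A'}
    (h₁ : s₁ ≫ a = r ≫ p₁) (h₁' : s₁ ≫ q' = t) (h₂ : s₂ ≫ a = r ≫ p₂) (h₂' : s₂ ≫ q' = t)
    {P : C} {g : P ⟶ U.obj Y} {p : P ⟶ Q} (hP : IsPullback g p (U.map f) (adj.unit.app Q)) :
    IsIso (L.map g) ↔ Nonempty (IsColimit (Cofork.ofπ q' (h₁'.trans h₂'.symm))) := by
  have := adj.isRightAdjoint
  have hUa := ha.map U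
  rw [hπ] at hUa
  -- By pullback pasting, the induced `k : U A' ⟶ P` is a pullback of `q`, hence a regular
  -- epimorphism.
  obtain ⟨k, hk₁, hk₂⟩ := hP.exists_lift (U.map q') (U.map a ≫ q) (by simpa using hUa.w.symm)
  have hk : IsPullback (U.map a) k q p := by
    refine IsPullback.of_bot (v₂₁ := g) (v₂₂ := adj.unit.app Q) (h₃₁ := U.map f) ?_ hk₂.symm hP.flip
    rwa [hk₁]
  have : IsRegularEpi k := isRegularEpi_of_isPullback hk
  have hUr := hr.map U
  rw [U.map_comp, hπ, ← Category.assoc] at hUr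
  obtain ⟨τ, hτ₁, hτ₂⟩ := hP.exists_lift (U.map t) (U.map r ≫ U.map p₁ ≫ q)
    (by simpa using hUr.w.symm)
  have hτ : IsPullback (U.map r) τ (U.map p₁ ≫ q) p := by
    refine IsPullback.of_bot (v₂₁ := g) (v₂₂ := adj.unit.app Q) (h₃₁ := U.map f) ?_ hτ₂.symm hP.flip
    rwa [hτ₁]
  have hs₁ : U.map s₁ ≫ k = τ := by
    refine hP.hom_ext ?_ ?_
    · rw [Category.assoc, hk₁, hτ₁, ← U.map_comp, h₁']
    · rw [Category.assoc, hk₂, hτ₂, ← U.map_comp_assoc, h₁, U.map_comp_assoc]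
  have hs₂ : U.map s₂ ≫ k = τ := by
    refine hP.hom_ext ?_ ?_
    · rw [Category.assoc, hk₁, hτ₁, ← U.map_comp, h₂']
    · rw [Category.assoc, hk₂, hτ₂, ← U.map_comp_assoc, h₂, U.map_comp_assoc, hq.w]
  have hker : IsKernelPair k (U.map s₁) (U.map s₂) := by
    refine isKernelPair_of_isPullback hq hk hτ ?_ hs₁ ?_ hs₂
    · simp only [← U.map_comp, h₁]
    · simp only [← U.map_comp, h₂]
  obtain ⟨σ, hσ⟩ := U.map_surjective (k ≫ adj.unit.app P)
  obtain ⟨w, ⟨hcol⟩⟩ := exists_isColimit_of_reflection adj hker.toCoequalizer' hσ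
  have hfac : σ ≫ L.map g ≫ adj.counit.app Y = q' := by
    apply U.map_injective
    rw [U.map_comp, hσ, U.map_comp, Category.assoc, adj.unit_naturality_assoc,
      adj.right_triangle_components, Category.comp_id, hk₁]
  rw [nonempty_isColimit_cofork_iff_isIso hcol _ hfac]
  -- The counit is invertible because `U` is fully faithful.
  exact (isIso_comp_right_iff _ _).symm

end Reflections

/-! ### Semi-localizations versus stable coequalizers -/

section SemiLocalizationOfExact

variable {X : Type u} [Category.{v} X] {C : Type u'} [Category.{v'} C]

theorem hasStableCoequalizers_of_isSemiLocalization [BarrExact C] {U : X ⥤ C}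
    (hU : IsSemiLocalization U) :
    HasFiniteLimits X ∧ HasStableCoequalizersOfEquivalenceRelations X := by
  obtain ⟨_, _, L, adj, hsle⟩ := hU
  let _ : Reflective U := { L := L, adj := adj }
  have hlim : HasFiniteLimits X := ⟨fun J _ _ => hasLimitsOfShape_of_reflective U⟩
  have := adj.isRightAdjoint
  have hpres : ∀ {R A : X} (p₁ p₂ : R ⟶ A) [IsEquivalenceRelation p₁ p₂],
      ∃ (Q : C) (q : U.obj A ⟶ Q) (_ : IsRegularEpi q) (_ : IsKernelPair q (U.map p₁) (U.map p₂))
        (π : A ⟶ L.obj Q) (_ : U.map π = q ≫ adj.unit.app Q) (w : p₁ ≫ π = p₂ ≫ π),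
        Nonempty (IsColimit (Cofork.ofπ π w)) := by
    intro R A p₁ p₂ _
    have := isEquivalenceRelation_map U p₁ p₂
    obtain ⟨Q, q, hq, hk⟩ := BarrExact.exists_isRegularEpi (U.map p₁) (U.map p₂)
    obtain ⟨π, hπ⟩ := U.map_surjective (q ≫ adj.unit.app Q)
    exact ⟨Q, q, hq, hk, π, hπ, exists_isColimit_of_reflection adj hk.toCoequalizer' hπ⟩
  refine ⟨hlim, ⟨fun p₁ p₂ _ => ?_, ?_⟩⟩
  · obtain ⟨Q, q, -, -, π, -, w, ⟨h⟩⟩ := hpres p₁ p₂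
    exact HasColimit.mk ⟨_, h⟩
  · intro R A Q₀ p₁ p₂ _ q₀ w₀ ⟨h₀⟩ Y A' S f a q' ha r t hr s₁ s₂ h₁ h₁' h₂ h₂'
    obtain ⟨Q, q, _, hk, π, hπ, w, ⟨h⟩⟩ := hpres p₁ p₂
    -- The given coequalizer is replaced by the isomorphic one that the reflector produces.
    obtain ⟨φ, hφ⟩ : ∃ φ : Q₀ ⟶ L.obj Q, q₀ ≫ φ = π :=
      ⟨h₀.desc (Cofork.ofπ π w), Cofork.IsColimit.π_desc h₀⟩
    have : IsIso φ := (nonempty_isColimit_cofork_iff_isIso h₀ w hφ).1 ⟨h⟩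
    subst hφ
    refine (isIso_map_iff_isColimit hk hπ (f := f ≫ φ) (a := a) ?_ (r := r) ?_ h₁ h₁' h₂ h₂'
      (IsPullback.of_hasPullback _ _)).1 ?_
    · simpa using ha.paste_vert (IsPullback.of_vert_isIso (fst := f) (snd := 𝟙 Y) (f := φ)
        (g := f ≫ φ) ⟨by simp⟩)
    · simpa using hr.paste_vert (IsPullback.of_vert_isIso (fst := f) (snd := 𝟙 Y) (f := φ)
        (g := f ≫ φ) ⟨by simp⟩)
    · have := hsle (f ≫ φ) _ _ (IsPullback.of_hasPullback _ _)
      -- `L.map g` is a pullback of `L` of a unit, which is invertible for a full reflective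
      -- subcategory.
      exact this.isIso_fst_of_isIso

/-- Let `U` be a finite limit preserving full embedding of `X` in an exact category that preserves
regular epimorphisms. If `X` has stable coequalizers of equivalence relations, and every object of
the exact category is a quotient of an object of `X` by an equivalence relation in `X`, then `U` is a
semi-localization. -/
theorem isSemiLocalization_of_hasStableCoequalizers [BarrExact C] [HasFiniteLimits X]
    (hX : HasStableCoequalizersOfEquivalenceRelations X) (U : X ⥤ C) [U.Full] [U.Faithful]
    [PreservesFiniteLimits U] (hU : ∀ {A B : X} (f : A ⟶ B), IsRegularEpi f → IsRegularEpi (U.map f))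
    (hC : ∀ F : C, ∃ (R A : X) (p₁ p₂ : R ⟶ A) (q : U.obj A ⟶ F),
      IsRegularEpi q ∧ IsKernelPair q (U.map p₁) (U.map p₂)) :
    IsSemiLocalizationWithRegularEpiUnits U := by
  have hcoeq : ∀ {F : C} {R A : X} {p₁ p₂ : R ⟶ A} {q : U.obj A ⟶ F},
      IsKernelPair q (U.map p₁) (U.map p₂) → IsEquivalenceRelation p₁ p₂ := by
    intro F R A p₁ p₂ q hq
    have := isEquivalenceRelation_of_isKernelPair hq
    exact isEquivalenceRelation_of_map U p₁ p₂
  have : U.IsRightAdjoint := by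
    -- The coequalizer of `R ⇉ A` in `X` is the reflection of the quotient `F` of `U A` by `U R`.
    have : ∀ F : C, HasInitial (StructuredArrow F U) := by
      intro F
      obtain ⟨R, A, p₁, p₂, q, hq, hk⟩ := hC F
      have := hcoeq hk
      have := hX.hasCoequalizer p₁ p₂
      have wπ : U.map p₁ ≫ U.map (coequalizer.π p₁ p₂) = U.map p₂ ≫ U.map (coequalizer.π p₁ p₂) := by
        rw [← U.map_comp, coequalizer.condition, U.map_comp]
      obtain ⟨η, hη⟩ : ∃ η, q ≫ η = U.map (coequalizer.π p₁ p₂) :=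
        ⟨hk.toCoequalizer'.desc (Cofork.ofπ _ wπ), Cofork.IsColimit.π_desc hk.toCoequalizer'⟩
      have hepi : Epi q := inferInstance
      have (s : StructuredArrow F U) : Nonempty (StructuredArrow.mk η ⟶ s) := by
        obtain ⟨k, hk'⟩ := U.map_surjective (q ≫ s.hom)
        have hk₀ : p₁ ≫ k = p₂ ≫ k := U.map_injective (by simp [hk', hk.w_assoc])
        refine ⟨StructuredArrow.homMk (coequalizer.desc k hk₀) ?_⟩
        rw [← cancel_epi q, ← hk', StructuredArrow.mk_hom_eq_self, reassoc_of% hη, ← U.map_comp,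
          coequalizer.π_desc]
      have (s : StructuredArrow F U) : Subsingleton (StructuredArrow.mk η ⟶ s) := by
        refine ⟨fun d d' => StructuredArrow.hom_ext _ _ (coequalizer.hom_ext (U.map_injective ?_))⟩
        have h₁ := StructuredArrow.w d
        have h₂ := StructuredArrow.w d'
        simp only [StructuredArrow.mk_hom_eq_self] at h₁ h₂
        rw [U.map_comp, U.map_comp, ← hη, Category.assoc, Category.assoc, h₁, h₂]
      exact hasInitial_of_unique (StructuredArrow.mk η)
    exact isRightAdjointOfStructuredArrowInitials U
  let adj := Adjunction.ofIsRightAdjoint U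
  refine ⟨inferInstance, inferInstance, U.leftAdjoint, adj, ?_, ?_⟩
  · intro Q P Y f g p hP
    obtain ⟨R, A, p₁, p₂, q, _, hk⟩ := hC Q
    obtain ⟨π, hπ⟩ := U.map_surjective (q ≫ adj.unit.app Q)
    have := hcoeq hk
    obtain ⟨w, hcol⟩ := exists_isColimit_of_reflection adj hk.toCoequalizer' hπ
    have e₁ : pullback.fst (p₁ ≫ π) f ≫ p₁ ≫ π = pullback.snd (p₁ ≫ π) f ≫ f := pullback.condition
    have := (isIso_map_iff_isColimit hk hπ (IsPullback.of_hasPullback π f)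
      (IsPullback.of_hasPullback (p₁ ≫ π) f)
      (s₁ := pullback.lift (pullback.fst _ _ ≫ p₁) (pullback.snd _ _) (by simpa using e₁))
      (s₂ := pullback.lift (pullback.fst _ _ ≫ p₂) (pullback.snd _ _) (by simpa [← w] using e₁))
      (pullback.lift_fst _ _ _) (pullback.lift_snd _ _ _) (pullback.lift_fst _ _ _)
      (pullback.lift_snd _ _ _) hP).2 (hX.stable p₁ p₂ π w hcol f _ _ (IsPullback.of_hasPullback π f)
        _ _ (IsPullback.of_hasPullback (p₁ ≫ π) f) _ _ (pullback.lift_fst _ _ _)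
        (pullback.lift_snd _ _ _) (pullback.lift_fst _ _ _) (pullback.lift_snd _ _ _))
    -- A commutative square with two opposite sides invertible, here `L.map g` and `L` of the unit,
    -- is a pullback.
    exact IsPullback.of_horiz_isIso ⟨by rw [← Functor.map_comp, ← Functor.map_comp, hP.w]⟩
  · intro Q
    obtain ⟨R, A, p₁, p₂, q, _, hk⟩ := hC Q
    obtain ⟨π, hπ⟩ := U.map_surjective (q ≫ adj.unit.app Q)
    obtain ⟨w, ⟨hcol⟩⟩ := exists_isColimit_of_reflection adj hk.toCoequalizer' hπ
    have := hU π ⟨⟨Cofork.IsColimit.regularEpi hcol⟩⟩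
    rw [hπ] at this
    exact isRegularEpi_of_comp q _

/-- A category with finite limits and stable coequalizers of equivalence relations is regular. -/
theorem regular_of_hasStableCoequalizers [HasFiniteLimits X]
    (hX : HasStableCoequalizersOfEquivalenceRelations X) : Regular X where
  hasCoequalizer_of_isKernelPair h :=
    have := isEquivalenceRelation_of_isKernelPair h
    hX.hasCoequalizer _ _
  regularEpiIsStableUnderBaseChange := by
    refine ⟨?_⟩
    intro A Y A' Q f q a q' h (hq : IsRegularEpi q)
    have hk := IsKernelPair.of_hasPullback q
    have := isEquivalenceRelation_of_isKernelPair hk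
    have e₁ : pullback.fst (pullback.fst q q ≫ q) f ≫ pullback.fst q q ≫ q =
      pullback.snd (pullback.fst q q ≫ q) f ≫ f := pullback.condition
    obtain ⟨hcol⟩ := hX.stable _ _ q hk.w ⟨hk.toCoequalizer'⟩ f a q' h _ _
      (IsPullback.of_hasPullback (pullback.fst q q ≫ q) f)
      (h.lift (pullback.fst _ _ ≫ pullback.fst q q) (pullback.snd _ _) (by simpa using e₁))
      (h.lift (pullback.fst _ _ ≫ pullback.snd q q) (pullback.snd _ _)
        (by simpa [← hk.w] using e₁))
      (h.lift_fst _ _ _) (h.lift_snd _ _ _) (h.lift_fst _ _ _) (h.lift_snd _ _ _)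
    exact ⟨⟨Cofork.IsColimit.regularEpi hcol⟩⟩

end SemiLocalizationOfExact

/-! ### Exactness of full subcategories -/

section FullSubcategories

variable {E : Type u} [Category.{v} E] {P : ObjectProperty E}

theorem prop_of_isPullback [P.IsClosedUnderLimitsOfShape WalkingCospan] {W A B D : E} {a : W ⟶ A}
    {b : W ⟶ B} {f : A ⟶ D} {g : B ⟶ D} (h : IsPullback a b f g) (hA : P A) (hB : P B) (hD : P D) :
    P W := by
  refine P.prop_of_isLimit h.isLimit ?_
  rintro (_ | _ | _)
  exacts [hD, hA, hB]

/-- The coequalizer in the ambient category of a kernel pair of a morphism of a full subcategory that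
contains it is a coequalizer in the subcategory. -/
theorem isColimit_cofork_of_ι {R F Q : P.FullSubcategory} {p₁ p₂ : R ⟶ F} {q : F ⟶ Q}
    [IsRegularEpi (P.ι.map q)] (hk : IsKernelPair (P.ι.map q) (P.ι.map p₁) (P.ι.map p₂)) :
    ∃ w : p₁ ≫ q = p₂ ≫ q, Nonempty (IsColimit (Cofork.ofπ q w)) := by
  refine ⟨P.ι.map_injective (by simpa using hk.w), ⟨?_⟩⟩
  exact isColimitOfIsColimitCoforkMap P.ι _ hk.toCoequalizer'

variable [P.IsClosedUnderLimitsOfShape WalkingCospan]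
  [P.IsClosedUnderLimitsOfShape (Discrete PEmpty.{1})]

theorem hasFiniteLimits_fullSubcategory [HasFiniteLimits E] : HasFiniteLimits P.FullSubcategory :=
  have : HasTerminal P.FullSubcategory := inferInstance
  have : HasPullbacks P.FullSubcategory := inferInstance
  hasFiniteLimits_of_hasTerminal_and_pullbacks

theorem preservesFiniteLimits_ι [HasFiniteLimits E] : PreservesFiniteLimits P.ι := by
  have := hasFiniteLimits_fullSubcategory (P := P)
  have : PreservesLimitsOfShape (Discrete PEmpty.{1}) P.ι := inferInstance
  have : PreservesLimitsOfShape WalkingCospan P.ι := inferInstance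
  exact preservesFiniteLimits_of_preservesTerminal_and_pullbacks P.ι

variable [BarrExact E] (hP : ∀ {R F Q : E} (p₁ p₂ : R ⟶ F) (q : F ⟶ Q), P R → P F →
  IsRegularEpi q → IsKernelPair q p₁ p₂ → P Q)

include hP in
-- The image of `f` in `E` is the quotient of `F` by its kernel pair, so `hP` places it in the
-- subcategory.
theorem exists_fac_ι {R F B : P.FullSubcategory} {p₁ p₂ : R ⟶ F} {f : F ⟶ B}
    (hk : IsKernelPair f p₁ p₂) :
    ∃ (Q : P.FullSubcategory) (q : F ⟶ Q) (m : Q ⟶ B) (w : p₁ ≫ q = p₂ ≫ q),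
      IsRegularEpi (P.ι.map q) ∧ Nonempty (IsColimit (Cofork.ofπ q w)) ∧ q ≫ m = f := by
  have := preservesFiniteLimits_ι (P := P)
  obtain ⟨I, e, m, he, hm, hem⟩ := exists_regularEpi_mono_fac (P.ι.map f)
  have hk' := hk.map P.ι
  rw [← hem] at hk'
  replace hk' : IsKernelPair e (P.ι.map p₁) (P.ι.map p₂) :=
    IsKernelPair.cancel_right_of_mono hk'
  obtain ⟨Q, rfl⟩ : ∃ Q : P.FullSubcategory, Q.obj = I :=
    ⟨⟨I, hP _ _ e R.property F.property he hk'⟩, rfl⟩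
  obtain ⟨q, hq⟩ := P.ι.map_surjective (X := F) (Y := Q) e
  obtain ⟨m', hm'⟩ := P.ι.map_surjective (X := Q) (Y := B) m
  subst hq
  subst hm'
  obtain ⟨w, hw⟩ := isColimit_cofork_of_ι hk'
  exact ⟨Q, q, m', w, he, hw, P.ι.map_injective (by simpa using hem)⟩

include hP in
theorem isRegularEpi_ι_iff {F G : P.FullSubcategory} (f : F ⟶ G) :
    IsRegularEpi (P.ι.map f) ↔ IsRegularEpi f := by
  have := preservesFiniteLimits_ι (P := P)
  have := hasFiniteLimits_fullSubcategory (P := P)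
  have hk := IsKernelPair.of_hasPullback f
  refine ⟨fun h => ?_, fun h => ?_⟩
  · obtain ⟨w, ⟨hw⟩⟩ := isColimit_cofork_of_ι (hk.map P.ι)
    exact ⟨⟨Cofork.IsColimit.regularEpi hw⟩⟩
  · obtain ⟨Q, q, m, w, hq, ⟨hw⟩, hqm⟩ := exists_fac_ι hP hk
    have : IsIso m := (nonempty_isColimit_cofork_iff_isIso hw hk.w hqm).1 ⟨hk.toCoequalizer'⟩
    rw [← hqm, P.ι.map_comp]
    infer_instance

include hP in
/-- A full subcategory of an exact category that is closed under finite limits and under quotients by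
equivalence relations is exact. -/
theorem barrExact_fullSubcategory : BarrExact P.FullSubcategory :=
  have := preservesFiniteLimits_ι (P := P)
  { hasFiniteLimits_fullSubcategory (P := P) with
    hasCoequalizer_of_isKernelPair := fun h => by
      obtain ⟨Q, q, m, w, -, ⟨hw⟩, -⟩ := exists_fac_ι hP h
      exact HasColimit.mk ⟨_, hw⟩
    regularEpiIsStableUnderBaseChange := by
      refine ⟨fun {A Y A' Q f q a q'} h hq => ?_⟩
      change IsRegularEpi _ at hq
      change IsRegularEpi _
      rw [← isRegularEpi_ι_iff hP] at hq ⊢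
      exact isRegularEpi_of_isPullback (h.map P.ι)
    exists_isKernelPair := fun {R A} p₁ p₂ _ => by
      have := hasFiniteLimits_fullSubcategory (P := P)
      have := isEquivalenceRelation_map P.ι p₁ p₂
      obtain ⟨I, e, he, hk⟩ := BarrExact.exists_isRegularEpi (P.ι.map p₁) (P.ι.map p₂)
      obtain ⟨Q, rfl⟩ : ∃ Q : P.FullSubcategory, Q.obj = I :=
        ⟨⟨I, hP _ _ e R.property A.property he hk⟩, rfl⟩
      obtain ⟨q, hq⟩ := P.ι.map_surjective (X := A) (Y := Q) e
      subst hq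
      exact ⟨Q, q, IsPullback.of_map P.ι (P.ι.map_injective (by simpa using hk.w)) hk⟩ }

end FullSubcategories

/-! ### Closure properties of quotients by equivalence relations -/

section Quotients

variable {E : Type u} [Category.{v} E]

/-- The quotients of the objects in `S` by equivalence relations in `S`. -/
def quotients (S : ObjectProperty E) : ObjectProperty E := fun F =>
  ∃ (R A : E) (p₁ p₂ : R ⟶ A) (q : A ⟶ F), S R ∧ S A ∧ IsRegularEpi q ∧ IsKernelPair q p₁ p₂

theorem le_quotients (S : ObjectProperty E) : S ≤ quotients S := fun A hA =>
  ⟨A, A, 𝟙 A, 𝟙 A, 𝟙 A, hA, hA, inferInstance, IsKernelPair.id_of_mono _⟩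

theorem isClosedUnderLimitsOfShape_pempty (S : ObjectProperty E)
    [S.IsClosedUnderLimitsOfShape (Discrete PEmpty.{1})] :
    (quotients S).IsClosedUnderLimitsOfShape (Discrete PEmpty.{1}) where
  limitsOfShape_le := by
    rintro W ⟨h⟩
    exact le_quotients S _ (S.prop_of_isLimit h.isLimit (by rintro ⟨⟨⟩⟩))

/-- Since `R = A ×_Q A`, one has `B ×_Q D = (B ×_A R) ×_A D`; this trades a pullback over a quotient
for pullbacks over `A`. -/
theorem isPullback_comp_of_isKernelPair [HasPullbacks E] {R A Q B D : E} {p₁ p₂ : R ⟶ A} {q : A ⟶ Q}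
    (hk : IsKernelPair q p₁ p₂) (f : B ⟶ A) (g : D ⟶ A) :
    IsPullback (pullback.fst (pullback.snd f p₁ ≫ p₂) g ≫ pullback.fst f p₁)
      (pullback.snd (pullback.snd f p₁ ≫ p₂) g) (f ≫ q) (g ≫ q) :=
  (IsPullback.of_hasPullback _ _).paste_horiz
    ((IsPullback.of_hasPullback f p₁).flip.paste_horiz hk.flip).flip

/-- The morphism between two pullbacks that is induced by two regular epimorphisms is a regular
epimorphism. -/
theorem exists_isRegularEpi_of_isPullback [Regular E] {W W' A B A' B' D : E} {a : W ⟶ A} {b : W ⟶ B}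
    {f : A ⟶ D} {g : B ⟶ D} (h : IsPullback a b f g) (e : A' ⟶ A) (d : B' ⟶ B) [IsRegularEpi e]
    [IsRegularEpi d] {a' : W' ⟶ A'} {b' : W' ⟶ B'} (h' : IsPullback a' b' (e ≫ f) (d ≫ g)) :
    ∃ k : W' ⟶ W, IsRegularEpi k ∧ k ≫ a = a' ≫ e ∧ k ≫ b = b' ≫ d := by
  have t : IsPullback (pullback.snd e a ≫ b) (pullback.fst e a) g (e ≫ f) :=
    (IsPullback.of_hasPullback e a).flip.paste_horiz h.flip
  obtain ⟨k, hk₁, hk₂⟩ := t.exists_lift (b' ≫ d) a' (by simpa using h'.w.symm)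
  have hk : IsPullback b' k d (pullback.snd e a ≫ b) := by
    refine IsPullback.of_bot (v₂₁ := pullback.fst e a) (v₂₂ := g) (h₃₁ := e ≫ f) ?_ hk₁.symm t
    rw [hk₂]
    exact h'.flip
  have : IsRegularEpi k := isRegularEpi_of_isPullback hk
  exact ⟨k ≫ pullback.snd e a, inferInstance,
    by rw [Category.assoc, ← pullback.condition, reassoc_of% hk₂], by rw [Category.assoc, hk₁]⟩

theorem mono_prodLift_of_isPullback [HasBinaryProducts E] {W A B D : E} {a : W ⟶ A} {b : W ⟶ B}
    {f : A ⟶ D} {g : B ⟶ D} (h : IsPullback a b f g) : Mono (prod.lift a b) :=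
  have : JointlyMono₂ a b := ⟨fun _ _ _ h₁ h₂ => h.hom_ext h₁ h₂⟩
  mono_prodLift a b

/-- As `a` and `b` are jointly monic, the kernel pair of `k` is the intersection, inside `W' ⨯ W'`,
of those of `k ≫ a` and `k ≫ b`. -/
theorem isPullback_lift_isKernelPair [HasBinaryProducts E] {W W' A B D K KA KB : E} {a : W ⟶ A}
    {b : W ⟶ B} {f : A ⟶ D} {g : B ⟶ D} (h : IsPullback a b f g) {k : W' ⟶ W} {k₁ k₂ : K ⟶ W'}
    (hk : IsKernelPair k k₁ k₂) {a₁ a₂ : KA ⟶ W'} (ha : IsKernelPair (k ≫ a) a₁ a₂)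
    {b₁ b₂ : KB ⟶ W'} (hb : IsKernelPair (k ≫ b) b₁ b₂) :
    IsPullback (ha.lift k₁ k₂ (by simp [hk.w_assoc])) (hb.lift k₁ k₂ (by simp [hk.w_assoc]))
      (prod.lift a₁ a₂) (prod.lift b₁ b₂) := by
  refine IsPullback.mk' ?_ (fun T φ φ' h₁ h₂ => ?_) (fun T x y w => ?_)
  · simp only [prod.comp_lift, IsKernelPair.lift_fst, IsKernelPair.lift_snd]
  · refine hk.hom_ext ?_ ?_
    · simpa only [Category.assoc, IsKernelPair.lift_fst] using h₁ =≫ a₁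
    · simpa only [Category.assoc, IsKernelPair.lift_snd] using h₁ =≫ a₂
  · have w₁ := w =≫ prod.fst
    have w₂ := w =≫ prod.snd
    simp only [Category.assoc, prod.lift_fst, prod.lift_snd] at w₁ w₂
    refine ⟨hk.lift (x ≫ a₁) (x ≫ a₂) (h.hom_ext ?_ ?_), ha.hom_ext ?_ ?_, hb.hom_ext ?_ ?_⟩
    · simp only [Category.assoc, ha.w]
    · simp only [w₁, w₂, Category.assoc, hb.w]
    · simp only [Category.assoc, IsKernelPair.lift_fst]
    · simp only [Category.assoc, IsKernelPair.lift_snd]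
    · simp only [Category.assoc, IsKernelPair.lift_fst, w₁]
    · simp only [Category.assoc, IsKernelPair.lift_snd, w₂]

/-- A class of objects of a regular category that contains a cover of each regular epimorphism onto
one of its objects, and that is closed under images. -/
structure IsGenerating (S : ObjectProperty E) : Prop where
  prop_image : ∀ {T G A : E} (q : T ⟶ G) (m : G ⟶ A), S T → S A → IsRegularEpi q → Mono m → S G
  exists_lift : ∀ {P B : E} (g : P ⟶ B), S B → IsRegularEpi g →
    ∃ (B' : E) (s : B' ⟶ P), S B' ∧ IsRegularEpi (s ≫ g)

variable {S : ObjectProperty E} [S.IsClosedUnderLimitsOfShape WalkingCospan]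
  [S.IsClosedUnderLimitsOfShape (Discrete PEmpty.{1})]

theorem prop_prod [HasFiniteLimits E] {A B : E} (hA : S A) (hB : S B) : S (A ⨯ B) :=
  prop_of_isPullback (IsPullback.of_is_product (prodIsProd A B) terminalIsTerminal)
    hA hB (S.prop_of_isLimit (limit.isLimit (Functor.empty E)) (by rintro ⟨⟨⟩⟩))

variable [Regular E] (hS : IsGenerating S)

include hS

/-- The maps `f` and `g` need not lift along `q`, but they do after passing to covers in `S`. The
pullback of the covers lies in `S`, and `W` is its image in `A ⨯ B`. -/
theorem prop_of_isPullback_quotients {F A B W : E} (hF : quotients S F) (hA : S A) (hB : S B)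
    {f : A ⟶ F} {g : B ⟶ F} {a : W ⟶ A} {b : W ⟶ B} (h : IsPullback a b f g) : S W := by
  obtain ⟨R, A₀, p₁, p₂, q, hR, hA₀, _, hk⟩ := hF
  obtain ⟨A', s, hA', hs⟩ := hS.exists_lift (pullback.fst f q) hA inferInstance
  obtain ⟨B', t, hB', ht⟩ := hS.exists_lift (pullback.fst g q) hB inferInstance
  have h' := isPullback_comp_of_isKernelPair hk (s ≫ pullback.snd f q) (t ≫ pullback.snd g q)
  rw [Category.assoc, Category.assoc, ← pullback.condition, ← pullback.condition,
    ← Category.assoc s, ← Category.assoc t] at h'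
  obtain ⟨k, hk, -, -⟩ := exists_isRegularEpi_of_isPullback h _ _ h'
  refine hS.prop_image k (prod.lift a b) ?_ (prop_prod hA hB) hk (mono_prodLift_of_isPullback h)
  exact prop_of_isPullback (IsPullback.of_hasPullback _ _)
    (prop_of_isPullback (IsPullback.of_hasPullback _ _) hA' hR hA₀) hB' hA₀

/-- Covers of `F` and `G` by objects of `S` give a cover `k` of `W` by an object of `S`; its kernel
pair is an intersection of two pullbacks over `F` and `G`, hence also in `S`. -/
theorem quotients_of_isPullback {F G H W : E} (hF : quotients S F) (hG : quotients S G)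
    (hH : quotients S H) {f : F ⟶ H} {g : G ⟶ H} {a : W ⟶ F} {b : W ⟶ G}
    (h : IsPullback a b f g) : quotients S W := by
  obtain ⟨-, A, -, -, c, -, hA, _, -⟩ := id hF
  obtain ⟨-, B, -, -, d, -, hB, _, -⟩ := id hG
  have h' := IsPullback.of_hasPullback (c ≫ f) (d ≫ g)
  have hW' := prop_of_isPullback_quotients hS hH hA hB h'
  obtain ⟨k, hk, -, -⟩ := exists_isRegularEpi_of_isPullback h _ _ h'
  refine ⟨_, _, pullback.fst k k, pullback.snd k k, k, ?_, hW', hk, IsPullback.of_hasPullback _ _⟩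
  have ha := IsPullback.of_hasPullback (k ≫ a) (k ≫ a)
  have hb := IsPullback.of_hasPullback (k ≫ b) (k ≫ b)
  exact prop_of_isPullback (isPullback_lift_isKernelPair h (IsPullback.of_hasPullback k k) ha hb)
    (prop_of_isPullback_quotients hS hF hW' hW' ha)
    (prop_of_isPullback_quotients hS hG hW' hW' hb) (prop_prod hW' hW')

/-- With `A` in `S` covering `F`, the kernel pair of `c ≫ q` is an iterated pullback of quotients,
so some `B` in `S` covers it. Being the image of `B` in `A ⨯ A`, it lies in `S`. -/
theorem quotients_of_isKernelPair {R F Q : E} (p₁ p₂ : R ⟶ F) (q : F ⟶ Q) (hR : quotients S R)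
    (hF : quotients S F) (hq : IsRegularEpi q) (hk : IsKernelPair q p₁ p₂) : quotients S Q := by
  obtain ⟨-, A, -, -, c, -, hA, _, -⟩ := id hF
  have h := isPullback_comp_of_isKernelPair hk c c
  have hA' := le_quotients S _ hA
  obtain ⟨-, B, -, -, d, -, hB, hd, -⟩ := quotients_of_isPullback hS
    (quotients_of_isPullback hS hA' hR hF (IsPullback.of_hasPullback c p₁)) hA' hF
    (IsPullback.of_hasPullback (pullback.snd c p₁ ≫ p₂) c)
  exact ⟨_, A, _, _, c ≫ q, hS.prop_image d _ hB (prop_prod hA hA) hd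
    (mono_prodLift_of_isPullback h), hA, inferInstance, h⟩

theorem isClosedUnderLimitsOfShape_walkingCospan :
    (quotients S).IsClosedUnderLimitsOfShape WalkingCospan where
  limitsOfShape_le := by
    rintro W ⟨h⟩
    exact quotients_of_isPullback hS (h.prop_diag_obj _) (h.prop_diag_obj _) (h.prop_diag_obj _)
      (IsPullback.of_isLimit_cone h.isLimit)

end Quotients

/-! ### Generating classes from full embeddings -/

section Embeddings

variable {X : Type u'} [Category.{v'} X] {E : Type u} [Category.{v} E] [BarrExact E]
  (y : X ⥤ E) [y.Full]

theorem quotients_essImage_iff (F : E) :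
    quotients y.essImage F ↔ ∃ (R A : X) (p₁ p₂ : R ⟶ A) (q : y.obj A ⟶ F),
      IsRegularEpi q ∧ IsKernelPair q (y.map p₁) (y.map p₂) := by
  refine ⟨?_, fun ⟨R, A, p₁, p₂, q, hq, hk⟩ => ⟨_, _, y.map p₁, y.map p₂, q,
    y.obj_mem_essImage R, y.obj_mem_essImage A, hq, hk⟩⟩
  rintro ⟨R, A, p₁, p₂, q, ⟨R₀, ⟨i⟩⟩, ⟨A₀, ⟨j⟩⟩, hq, hk⟩
  obtain ⟨f₁, hf₁⟩ := y.map_surjective (i.hom ≫ p₁ ≫ j.inv)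
  obtain ⟨f₂, hf₂⟩ := y.map_surjective (i.hom ≫ p₂ ≫ j.inv)
  refine ⟨R₀, A₀, f₁, f₂, j.hom ≫ q, inferInstance,
    IsPullback.of_iso hk i.symm j.symm j.symm (Iso.refl _) ?_ ?_ ?_ ?_⟩ <;> simp [hf₁, hf₂]

variable [Regular X] [PreservesFiniteLimits y]

theorem isGenerating_essImage
    (hreg : ∀ {A B : X} (f : A ⟶ B), IsRegularEpi f → IsRegularEpi (y.map f))
    (hlift : ∀ {P : E} {B : X} (g : P ⟶ y.obj B), IsRegularEpi g →
      ∃ (B' : X) (e : B' ⟶ B) (s : y.obj B' ⟶ P), IsRegularEpi e ∧ s ≫ g = y.map e) :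
    IsGenerating y.essImage where
  prop_image := by
    rintro T G A q m ⟨T₀, ⟨i⟩⟩ ⟨A₀, ⟨j⟩⟩ _ _
    obtain ⟨f, hf⟩ := y.map_surjective (i.hom ≫ q ≫ m ≫ j.inv)
    obtain ⟨I, e, n, he, _, rfl⟩ := exists_regularEpi_mono_fac f
    have := hreg e he
    -- Two image factorizations of the same map, one taken in `X` and one in `E`: the diagonal is an
    -- isomorphism.
    have sq : CommSq (y.map e) (i.hom ≫ q) (y.map n) (m ≫ j.inv) := ⟨by simpa using hf⟩
    have : Mono sq.lift := mono_of_mono_fac sq.fac_right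
    have : IsRegularEpi sq.lift := by
      have : IsRegularEpi ((i.hom ≫ q) ≫ sq.lift) := by
        rwa [sq.fac_left]
      exact isRegularEpi_of_comp (i.hom ≫ q) sq.lift
    have : IsIso sq.lift := isIso_of_mono_of_strongEpi _
    exact ⟨I, ⟨(asIso sq.lift).symm⟩⟩
  exists_lift := by
    rintro P B g ⟨B₀, ⟨i⟩⟩ _
    obtain ⟨B', e, s, he, hs⟩ := hlift (g ≫ i.inv) inferInstance
    refine ⟨y.obj B', s, y.obj_mem_essImage B', ?_⟩
    rw [← Category.comp_id g, ← i.inv_hom_id, ← Category.assoc g, ← Category.assoc s, hs]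
    have := hreg e he
    infer_instance

end Embeddings

/-! ### Effective equivalence relations in sets and presheaves -/

section Presheaves

theorem isKernelPair_of_isColimit_types {R A Q : Type w₁} {p₁ p₂ : R ⟶ A}
    [h : IsEquivalenceRelation p₁ p₂] {q : A ⟶ Q} {w : p₁ ≫ q = p₂ ≫ q}
    (hq : IsColimit (Cofork.ofπ q w)) : IsKernelPair q p₁ p₂ := by
  have hm := jointlyMono₂_of_isEquivalenceRelation p₁ p₂
  obtain ⟨⟨e⟩⟩ := h
  let s : Setoid A := ⟨_, TypeCat.equivalence_of_equivalenceRelation e⟩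
  have ws : p₁ ≫ (↾(Quotient.mk s)) = p₂ ≫ (↾(Quotient.mk s)) := by
    ext r
    exact Quotient.sound ⟨r, rfl, rfl⟩
  obtain ⟨d, hd⟩ : ∃ d, q ≫ d = ↾(Quotient.mk s) :=
    ⟨hq.desc (Cofork.ofπ _ ws), Cofork.IsColimit.π_desc hq⟩
  refine (Types.isPullback_iff _ _ _ _).2 ⟨w, ?_, fun x y hxy => ?_⟩
  · rintro x y ⟨h₁, h₂⟩
    have := hm.right_cancellation (↾(fun _ : PUnit => x)) (↾(fun _ : PUnit => y))
      (by ext; exact h₁) (by ext; exact h₂)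
    exact congr($this PUnit.unit)
  · have h₁ : Quotient.mk s x = Quotient.mk s y := by
      have hx : d (q x) = Quotient.mk s x := congr($hd x)
      have hy : d (q y) = Quotient.mk s y := congr($hd y)
      rw [← hx, ← hy, hxy]
    exact Quotient.exact h₁

theorem isKernelPair_coequalizer_π_functor {D : Type u} [Category.{v} D] {R F : D ⥤ Type w₁}
    (p₁ p₂ : R ⟶ F) [IsEquivalenceRelation p₁ p₂] : IsKernelPair (coequalizer.π p₁ p₂) p₁ p₂ := by
  refine IsPullback.of_forall_isPullback_app fun U => ?_
  have := isEquivalenceRelation_map ((evaluation D (Type w₁)).obj U) p₁ p₂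
  exact isKernelPair_of_isColimit_types (p₁ := p₁.app U) (p₂ := p₂.app U) (h := this)
    (isColimitCoforkMapOfIsColimit ((evaluation D (Type w₁)).obj U) _
      (coequalizerIsCoequalizer p₁ p₂))

end Presheaves

/-! ### Exactness of regular sheaves -/

section Sheaves

/-- Take the quotient in presheaves and sheafify: sheafification preserves the kernel pair and fixes
`R` and `F` up to the counit. -/
theorem exists_isKernelPair_sheaf {D : Type u} [Category.{v} D] (J : GrothendieckTopology D)
    [HasSheafify J (Type w₁)] {R F : Sheaf J (Type w₁)} (p₁ p₂ : R ⟶ F)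
    [IsEquivalenceRelation p₁ p₂] :
    ∃ (Q : Sheaf J (Type w₁)) (q : F ⟶ Q), IsKernelPair q p₁ p₂ := by
  let p := sheafToPresheaf J (Type w₁)
  let a := presheafToSheaf J (Type w₁)
  let ε := sheafificationAdjunction J (Type w₁)
  have := isEquivalenceRelation_map p p₁ p₂
  have hk := (isKernelPair_coequalizer_π_functor (p.map p₁) (p.map p₂)).map a
  refine ⟨_, inv (ε.counit.app F) ≫ a.map (coequalizer.π (p.map p₁) (p.map p₂)),
    IsPullback.of_iso hk (asIso (ε.counit.app R)) (asIso (ε.counit.app F))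
      (asIso (ε.counit.app F)) (Iso.refl _) ?_ ?_ ?_ ?_⟩
  · exact ε.counit_naturality p₁
  · exact ε.counit_naturality p₂
  · simp
  · simp

variable (X : Type u) [Category.{v} X] [Regular X]

instance preservesFiniteLimits_regYoneda : PreservesFiniteLimits (regYoneda X) :=
  ⟨fun _ _ _ => inferInstance⟩

variable {X}

/-- A morphism of sheaves is a regular epimorphism if and only if the elements of its target lift
along a regular epimorphism of `X`. -/
theorem isRegularEpi_regSheaf_iff {F G : RegSheaf X} (f : F ⟶ G) :
    IsRegularEpi f ↔ ∀ (B : X) (b : (regYoneda X).obj B ⟶ G),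
      ∃ (B' : X) (e : B' ⟶ B) (c : (regYoneda X).obj B' ⟶ F),
        IsRegularEpi e ∧ c ≫ f = (regYoneda X).map e ≫ b := by
  have hepi : IsRegularEpi f ↔ Sheaf.IsLocallySurjective f := by
    rw [Sheaf.isLocallySurjective_iff_epi' (Type (max v u))]
    exact ⟨fun _ => inferInstance, fun _ => IsRegularEpiCategory.regularEpiOfEpi f⟩
  let Y {A : X} {H : RegSheaf X} : ((regYoneda X).obj A ⟶ H) ≃ H.obj.obj (Opposite.op A) :=
    (regularTopology X).uliftYonedaEquiv
  have key : ∀ {B B' : X} (b : (regYoneda X).obj B ⟶ G) (e : B' ⟶ B)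
      (c : (regYoneda X).obj B' ⟶ F), c ≫ f = (regYoneda X).map e ≫ b ↔
        f.hom.app _ (Y c) = G.obj.map e.op (Y b) := by
    intro B B' b e c
    rw [← (Y (A := B') (H := G)).injective.eq_iff]
    change f.hom.app _ (Y c) = _ ↔ _
    rw [GrothendieckTopology.uliftYonedaEquiv_naturality]
  rw [hepi]
  refine ⟨fun h B b => ?_, fun h => ⟨fun {U} s => ?_⟩⟩
  · obtain ⟨B', e, he, c, hc⟩ :=
      (regularTopology.mem_sieves_iff_hasEffectiveEpi _).1 (h.imageSieve_mem (Y b))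
    refine ⟨B', e, Y.symm c, inferInstance, (key b e _).2 ?_⟩
    rw [Equiv.apply_symm_apply]
    exact hc
  · obtain ⟨B', e, c, he, hc⟩ := h U (Y.symm s)
    refine (regularTopology.mem_sieves_iff_hasEffectiveEpi _).2
      ⟨B', e, inferInstance, Y c, ?_⟩
    simpa using (key _ e c).1 hc

instance barrExact_regSheaf : BarrExact (RegSheaf X) where
  hasCoequalizer_of_isKernelPair _ := inferInstance
  regularEpiIsStableUnderBaseChange := by
    refine ⟨fun {A Y A' Q f q a q'} h hq => ?_⟩
    change IsRegularEpi _ at hq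
    change IsRegularEpi _
    rw [isRegularEpi_regSheaf_iff] at hq ⊢
    intro B b
    obtain ⟨B', e, c, he, hc⟩ := hq B (b ≫ f)
    exact ⟨B', e, h.lift c ((regYoneda X).map e ≫ b) (by simpa using hc), he, h.lift_snd _ _ _⟩
  exists_isKernelPair p₁ p₂ _ := exists_isKernelPair_sheaf _ p₁ p₂

theorem isRegularEpi_regYoneda_map {A B : X} (f : A ⟶ B) (hf : IsRegularEpi f) :
    IsRegularEpi ((regYoneda X).map f) := by
  rw [isRegularEpi_regSheaf_iff]
  intro D b
  obtain ⟨b, rfl⟩ := (regYoneda X).map_surjective b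
  exact ⟨_, pullback.snd f b, (regYoneda X).map (pullback.fst f b), inferInstance,
    by rw [← Functor.map_comp, pullback.condition, Functor.map_comp]⟩

variable (X) in
theorem isGenerating_regYoneda : IsGenerating (regYoneda X).essImage := by
  refine isGenerating_essImage _ isRegularEpi_regYoneda_map fun {P B} g hg => ?_
  obtain ⟨B', e, c, he, hc⟩ := (isRegularEpi_regSheaf_iff g).1 hg B (𝟙 _)
  exact ⟨B', e, c, he, by simpa using hc⟩

theorem exists_isKernelPair_of_isQuotient {F : RegSheaf X} (hF : isQuotient X F) :
    ∃ (R A : X) (p₁ p₂ : R ⟶ A) (q : (regYoneda X).obj A ⟶ F),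
      IsRegularEpi q ∧ IsKernelPair q ((regYoneda X).map p₁) ((regYoneda X).map p₂) := by
  obtain ⟨R, A, p₁, p₂, _, q, w, ⟨hq⟩⟩ := hF
  have := isEquivalenceRelation_map (regYoneda X) p₁ p₂
  obtain ⟨Q, f, hf, hk⟩ := BarrExact.exists_isRegularEpi ((regYoneda X).map p₁) ((regYoneda X).map p₂)
  obtain ⟨d, rfl⟩ : ∃ d, q ≫ d = f :=
    ⟨hq.desc (Cofork.ofπ f hk.w), Cofork.IsColimit.π_desc hq⟩
  exact ⟨R, A, p₁, p₂, q, ⟨⟨Cofork.IsColimit.regularEpi hq⟩⟩, hk.cancel_right w⟩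

variable (X) in
-- Equivalence relations of sheaves are effective, so being a coequalizer of one and having it as
-- kernel pair of a regular epimorphism agree.
theorem isQuotient_eq : isQuotient X = quotients (regYoneda X).essImage := by
  ext F
  rw [quotients_essImage_iff]
  refine ⟨exists_isKernelPair_of_isQuotient, fun ⟨R, A, p₁, p₂, q, _, hk⟩ => ?_⟩
  have := isEquivalenceRelation_of_isKernelPair hk
  exact ⟨R, A, p₁, p₂, isEquivalenceRelation_of_map (regYoneda X) p₁ p₂, q, hk.w,
    ⟨hk.toCoequalizer'⟩⟩

end Sheaves

/-! ### The exact completion -/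

section ExReg

variable (X : Type u) [Category.{v} X] [Regular X]

instance : (isQuotient X).IsClosedUnderLimitsOfShape WalkingCospan := by
  rw [isQuotient_eq]
  exact isClosedUnderLimitsOfShape_walkingCospan (isGenerating_regYoneda X)

instance : (isQuotient X).IsClosedUnderLimitsOfShape (Discrete PEmpty.{1}) := by
  rw [isQuotient_eq]
  exact isClosedUnderLimitsOfShape_pempty _

theorem isQuotient_of_isKernelPair {R F Q : RegSheaf X} (p₁ p₂ : R ⟶ F) (q : F ⟶ Q)
    (hR : isQuotient X R) (hF : isQuotient X F) (hq : IsRegularEpi q)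
    (hk : IsKernelPair q p₁ p₂) : isQuotient X Q := by
  rw [isQuotient_eq] at *
  exact quotients_of_isKernelPair (isGenerating_regYoneda X) p₁ p₂ q hR hF hq hk

/-- The exact completion of a regular category is exact. -/
instance barrExact_exReg : BarrExact (ExReg X) :=
  barrExact_fullSubcategory (isQuotient_of_isKernelPair X)

instance : (toExReg X).Full := inferInstanceAs ((isQuotient X).lift _ _).Full

instance : (toExReg X).Faithful := inferInstanceAs ((isQuotient X).lift _ _).Faithful

instance : PreservesFiniteLimits (toExReg X) := by
  have := preservesFiniteLimits_ι (P := isQuotient X)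
  have : PreservesFiniteLimits (toExReg X ⋙ (isQuotient X).ι) :=
    inferInstanceAs (PreservesFiniteLimits (regYoneda X))
  exact ⟨fun J _ _ => preservesLimitsOfShape_of_reflects_of_preserves _ (isQuotient X).ι⟩

variable {X}

theorem isRegularEpi_toExReg_map {A B : X} (f : A ⟶ B) (hf : IsRegularEpi f) :
    IsRegularEpi ((toExReg X).map f) :=
  (isRegularEpi_ι_iff (isQuotient_of_isKernelPair X) _).1 (isRegularEpi_regYoneda_map f hf)

theorem exists_isKernelPair_exReg (F : ExReg X) :
    ∃ (R A : X) (p₁ p₂ : R ⟶ A) (q : (toExReg X).obj A ⟶ F),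
      IsRegularEpi q ∧ IsKernelPair q ((toExReg X).map p₁) ((toExReg X).map p₂) := by
  obtain ⟨R, A, p₁, p₂, q, hq, hk⟩ := exists_isKernelPair_of_isQuotient F.property
  obtain ⟨q, rfl⟩ := (isQuotient X).ι.map_surjective (X := (toExReg X).obj A) (Y := F) q
  exact ⟨R, A, p₁, p₂, q, (isRegularEpi_ι_iff (isQuotient_of_isKernelPair X) _).1 hq,
    IsPullback.of_map (isQuotient X).ι ((isQuotient X).ι.map_injective
      (by rw [Functor.map_comp, Functor.map_comp]; exact hk.w)) hk⟩

end ExReg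

/-! ### Invariance of exactness under equivalence -/

section Equivalences

variable {C : Type u} [Category.{v} C] {D : Type u'} [Category.{v'} D]

theorem isRegularEpi_map_iff_of_isEquivalence [HasPullbacks C] (F : C ⥤ D) [F.IsEquivalence]
    {A B : C} (f : A ⟶ B) : IsRegularEpi (F.map f) ↔ IsRegularEpi f := by
  have hk := IsKernelPair.of_hasPullback f
  refine ⟨fun _ => ⟨⟨Cofork.IsColimit.regularEpi
    (isColimitOfIsColimitCoforkMap F hk.w (IsKernelPair.toCoequalizer' (hk.map F)))⟩⟩, fun _ => ?_⟩
  exact ⟨⟨Cofork.IsColimit.regularEpi (isColimitCoforkMapOfIsColimit F hk.w hk.toCoequalizer')⟩⟩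

theorem barrExact_of_isEquivalence [BarrExact D] (F : C ⥤ D) [F.IsEquivalence] : BarrExact C :=
  have : HasFiniteLimits C := ⟨fun _ _ _ => Adjunction.hasLimitsOfShape_of_equivalence F⟩
  { hasCoequalizer_of_isKernelPair := fun {A B R f p₁ p₂} h => by
      have : HasCoequalizer (F.map p₁) (F.map p₂) :=
        Regular.hasCoequalizer_of_isKernelPair (h.map F)
      have : HasColimit (parallelPair p₁ p₂ ⋙ F) :=
        have : HasColimit (parallelPair ((parallelPair p₁ p₂ ⋙ F).map WalkingParallelPairHom.left)
          ((parallelPair p₁ p₂ ⋙ F).map WalkingParallelPairHom.right)) := this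
        hasColimit_of_iso (diagramIsoParallelPair _)
      exact Adjunction.hasColimit_of_comp_equivalence _ F
    regularEpiIsStableUnderBaseChange := by
      refine ⟨fun {A Y A' Q f q a q'} h hq => ?_⟩
      change IsRegularEpi _ at hq
      change IsRegularEpi _
      rw [← isRegularEpi_map_iff_of_isEquivalence F] at hq ⊢
      exact isRegularEpi_of_isPullback (h.map F)
    exists_isKernelPair := fun {R A} p₁ p₂ _ => by
      have := isEquivalenceRelation_map F p₁ p₂
      obtain ⟨B, f, hf⟩ := BarrExact.exists_isKernelPair (F.map p₁) (F.map p₂)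
      obtain ⟨g, hg⟩ := F.map_surjective (f ≫ (F.objObjPreimageIso B).inv)
      have hk : IsKernelPair (F.map g) (F.map p₁) (F.map p₂) := by
        rw [hg]
        exact hf.comp_of_mono
      exact ⟨_, g, IsPullback.of_map F (F.map_injective (by simpa using hk.w)) hk⟩ }

end Equivalences

/-! ### Size of the exact completion -/

section SmallModel

variable (X : Type u) [Category.{v} X] [Regular X]

/-- An object is determined up to isomorphism by a pair `R ⇉ A` presenting it, and the type of such
pairs lives in `max u v`. -/
instance essentiallySmall_exReg : EssentiallySmall.{max u v} (ExReg X) := by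
  refine (essentiallySmall_iff _).2 ⟨?_, inferInstance⟩
  choose R A p₁ p₂ q hq hk using exists_isKernelPair_exReg (X := X)
  let d (F : ExReg X) : Σ (R A : X), (R ⟶ A) × (R ⟶ A) := ⟨R F, A F, p₁ F, p₂ F⟩
  have hd : ∀ F G : ExReg X, d F = d G → Nonempty (F ≅ G) := by
    intro F G h
    -- Phrased through `d F`, so that rewriting along `h` moves the whole presentation of `G` at
    -- once.
    have : ∃ q' : (toExReg X).obj (d F).2.1 ⟶ G, IsRegularEpi q' ∧
        IsKernelPair q' ((toExReg X).map (d F).2.2.1) ((toExReg X).map (d F).2.2.2) := by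
      rw [h]
      exact ⟨q G, hq G, hk G⟩
    obtain ⟨q', hq', hk'⟩ := this
    exact ⟨(hk F).toCoequalizer'.coconePointUniqueUpToIso hk'.toCoequalizer'⟩
  refine small_of_injective (β := Σ (R A : X), (R ⟶ A) × (R ⟶ A))
    (f := fun s => d ((fromSkeleton (ExReg X)).obj s)) fun s t h => ?_
  rw [← toSkeleton_fromSkeleton_obj s, ← toSkeleton_fromSkeleton_obj t]
  exact toSkeleton_eq_toSkeleton_iff.2 (hd _ _ h)

/-- The exact completion has a model that is as small as the category itself. -/
theorem exists_equivalence_exReg :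
    ∃ (C : Type (max u v w₁)) (_ : Category.{max u v w₂} C), Nonempty (ExReg X ≌ C) :=
  let _ : Category.{max u v} (ULift.{w₁} (SmallModel.{max u v} (ExReg X))) := uliftCategory _
  ⟨ULiftHom.{w₂} (ULift.{w₁} (SmallModel.{max u v} (ExReg X))), ULiftHom.category,
    ⟨(equivSmallModel.{max u v} (ExReg X)).trans
      (ULiftHomULiftCategory.equiv (SmallModel.{max u v} (ExReg X)))⟩⟩

end SmallModel

end SemiLoc

theorem mainTheorem10 (X : Type u) [Category.{v} X] :
    List.TFAE [
      HasFiniteLimits X ∧ SemiLoc.HasStableCoequalizersOfEquivalenceRelations X,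
      ∃ (C : Type (max u v w₁)) (_ : Category.{max u v w₂} C) (_ : SemiLoc.BarrExact C)
        (U : X ⥤ C), SemiLoc.IsSemiLocalization U,
      ∃ (C : Type (max u v w₁)) (_ : Category.{max u v w₂} C) (_ : SemiLoc.BarrExact C)
        (U : X ⥤ C), SemiLoc.IsSemiLocalizationWithRegularEpiUnits U,
      ∃ _ : Regular X, SemiLoc.IsSemiLocalization (SemiLoc.toExReg X)] := by
  tfae_have 1 → 3 := by
    rintro ⟨_, hX⟩
    have := SemiLoc.regular_of_hasStableCoequalizers hX
    -- The exact completion itself has objects in `max u v + 1`; an equivalent model fits the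
    -- universes prescribed for `C`.
    obtain ⟨C, _, ⟨e⟩⟩ := SemiLoc.exists_equivalence_exReg.{u, v, w₁, w₂} X
    have := SemiLoc.barrExact_of_isEquivalence e.inverse
    refine ⟨C, _, this, SemiLoc.toExReg X ⋙ e.functor,
      SemiLoc.isSemiLocalization_of_hasStableCoequalizers hX _ ?_ ?_⟩
    · intro A B f hf
      exact (SemiLoc.isRegularEpi_map_iff_of_isEquivalence e.functor _).2
        (SemiLoc.isRegularEpi_toExReg_map f hf)
    · intro F
      obtain ⟨R, A, p₁, p₂, q, hq, hk⟩ := SemiLoc.exists_isKernelPair_exReg (e.inverse.obj F)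
      have := (SemiLoc.isRegularEpi_map_iff_of_isEquivalence e.functor _).2 hq
      exact ⟨R, A, p₁, p₂, e.functor.map q ≫ e.counit.app F, inferInstance,
        IsKernelPair.comp_of_mono (hk.map e.functor)⟩
  tfae_have 3 → 2 := by
    rintro ⟨C, _, _, U, h₁, h₂, L, adj, h, -⟩
    exact ⟨C, _, inferInstance, U, h₁, h₂, L, adj, h⟩
  tfae_have 2 → 1 := by
    rintro ⟨C, _, _, U, hU⟩
    exact SemiLoc.hasStableCoequalizers_of_isSemiLocalization hU
  tfae_have 1 → 4 := by
    rintro ⟨_, hX⟩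
    have := SemiLoc.regular_of_hasStableCoequalizers hX
    obtain ⟨h₁, h₂, L, adj, h, -⟩ := SemiLoc.isSemiLocalization_of_hasStableCoequalizers hX
      (SemiLoc.toExReg X) SemiLoc.isRegularEpi_toExReg_map SemiLoc.exists_isKernelPair_exReg
    exact ⟨this, h₁, h₂, L, adj, h⟩
  tfae_have 4 → 1 := by
    rintro ⟨_, hU⟩
    exact SemiLoc.hasStableCoequalizers_of_isSemiLocalization hU
  tfae_finish
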